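/- **Corollary 4.1 (Approximate Lindblad reduction).** Let $\mathcal H$ be a finite-dimensional Hilbert space with operator algebra $\mathfrak B(\mathcal H)$. For a $*$-algebra of matrices $\mathscr S$, a linear map $\mathcal L:\mathscr S\to\mathscr S$ is called a Lindblad generator on $\mathscr S$ if $\{e^{t\mathcal L}\}_{t\ge 0}$ is a quantum dynamical semigroup, i.e. every $e^{t\mathcal L}$, $t\ge 0$, is a completely positive trace-preserving (CPTP) map of $\mathscr S$. For each $\varepsilon\in\mathbb R$ let $\mathcal L_\varepsilon$ be a Lindblad generator on $\mathfrak B(\mathcal H)$, and put $\mathcal L_{(0)}=\mathcal L_{\varepsilon=0}$. Let $$\mathscr C_0=\operatorname{span}\{X\in\mathfrak B(\mathcal H) : \exists\,\omega\in\mathbb R,\ \mathcal L_{(0)}(X)=i\omega X\}$$ be the center manifold of $\mathcal L_{(0)}$, and let $\mathcal P_{(0)}$ be a CPTP projector ($\mathcal P_{(0)}^2=\mathcal P_{(0)}$) with image $\mathscr C_0$ that commutes with $\mathcal L_{(0)}$. Let $$\mathscr C_0=U\Big[\bigoplus_k\big(\mathfrak B(\mathcal H_{F,k})\otimes\tau_k\big)\oplus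 0_R\Big]U^\dagger$$ be a block decomposition of $\mathscr C_0$, with $U$ a unitary from $\bigoplus_k(\mathcal H_{F,k}\otimes\mathcal H_{G,k})\oplus\mathcal H_R$ onto $\mathcal H$ and $\tau_k$ a density operator of full rank on $\mathcal H_{G,k}$. Let $W_k:\mathcal H\to\mathcal H_{F,k}\otimes\mathcal H_{G,k}$ be the corresponding component of $U^\dagger$, let $\check{\mathscr C}_0=\bigoplus_k\mathfrak B(\mathcal H_{F,k})\subseteq\mathfrak B\big(\bigoplus_k\mathcal H_{F,k}\big)$, and define $\mathcal R_{(0)}:\mathfrak B(\mathcal H)\to\check{\mathscr C}_0$ and $\mathcal J_{(0)}:\check{\mathscr C}_0\to\mathfrak B(\mathcal H)$ by $$\mathcal R_{(0)}(X)=\bigoplus_k\operatorname{tr}_{\mathcal H_{G,k}}\!\big(W_k\,\mathcal P_{(0)}(X)\,W_k^\dagger\big),\qquad \mathcal J_{(0)}\Big(\bigoplus_k X_k\Big)=U\Big(\bigoplus_k (X_k\otimes\tau_k)\oplus 0_R\Big)U^\dagger .$$ Then $\mathcal R_{(0)}$ and $\mathcal J_{(0)}$ are CPTP, $\mathcal J_{(0)}\mathcal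 R_{(0)}=\mathcal P_{(0)}$ and $\mathcal R_{(0)}\mathcal J_{(0)}$ is the identity of $\check{\mathscr C}_0$. Moreover, for every $\varepsilon\in\mathbb R$, the reduced generator $\check{\mathcal L}_\varepsilon=\mathcal R_{(0)}\mathcal L_\varepsilon\mathcal J_{(0)}$ leaves $\check{\mathscr C}_0$ invariant and is a Lindblad generator on $\check{\mathscr C}_0$; and whenever $\mathcal L_\varepsilon=\sum_{k\ge0}\varepsilon^k\mathcal L_{(k)}$ with linear maps $\mathcal L_{(k)}$ on $\mathfrak B(\mathcal H)$ (convergent series), then $\check{\mathcal L}_\varepsilon=\sum_{k\ge0}\varepsilon^k\,\mathcal R_{(0)}\mathcal L_{(k)}\mathcal J_{(0)}$. -/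

import Mathlib

open scoped Matrix Kronecker ComplexOrder

/-! Throughout, operators on a finite-dimensional Hilbert space are complex square matrices
indexed by a finite type, `Matrix ι ι ℂ`. -/

/-- `Φ` restricts to a completely positive trace-preserving map from the matrix space `S` to the
matrix space `T`. Complete positivity is positivity of every amplification `id_m ⊗ Φ` on
`M_m(S)`; `Matrix.comp` reads an `m × m` matrix of matrices as one large matrix. -/
def IsCPTP {ι κ : Type*} [Fintype ι] [Fintype κ]
    (S : Submodule ℂ (Matrix ι ι ℂ)) (T : Submodule ℂ (Matrix κ κ ℂ))
    (Φ : Matrix ι ι ℂ →ₗ[ℂ] Matrix κ κ ℂ) : Prop :=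
  (∀ X ∈ S, Φ X ∈ T) ∧
  (∀ (m : ℕ) (X : Matrix (Fin m) (Fin m) (Matrix ι ι ℂ)), (∀ i j, X i j ∈ S) →
    (Matrix.comp (Fin m) (Fin m) ι ι ℂ X).PosSemidef →
    (Matrix.comp (Fin m) (Fin m) κ κ ℂ (X.map Φ)).PosSemidef) ∧
  (∀ X ∈ S, (Φ X).trace = X.trace)

/-- The exponential `e^{t L}` of a linear endomorphism of a finite-dimensional normed space. -/
noncomputable def endExp {V : Type*} [NormedAddCommGroup V] [NormedSpace ℂ V]
    [FiniteDimensional ℂ V] (L : Module.End ℂ V) (t : ℝ) : Module.End ℂ V :=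
  (NormedSpace.exp ((t : ℂ) • LinearMap.toContinuousLinearMap L) : V →L[ℂ] V).toLinearMap

section Propagator

attribute [local instance] Matrix.normedAddCommGroup Matrix.normedSpace

/-- The propagator `e^{t L}` of a super-operator `L`. (It does not depend on the norm used for
the exponential series: the space is finite-dimensional.) -/
noncomputable def propagator {ι : Type*} [Fintype ι] (L : Module.End ℂ (Matrix ι ι ℂ)) (t : ℝ) :
    Module.End ℂ (Matrix ι ι ℂ) :=
  endExp L t

end Propagator

/-- `L` is a Lindblad generator on the matrix algebra `S`: it maps `S` to itself, and
`{e^{t L}}_{t ≥ 0}` is a quantum dynamical semigroup on `S`, i.e. consists of completely positive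
trace-preserving maps of `S`. (As `L` preserves `S`, the restriction of `e^{t L}` to `S` is the
exponential of the restriction of `t L`; it does not depend on `L` outside `S`.) -/
def IsLindbladGeneratorOn {ι : Type*} [Fintype ι]
    (S : Submodule ℂ (Matrix ι ι ℂ)) (L : Module.End ℂ (Matrix ι ι ℂ)) : Prop :=
  (∀ X ∈ S, L X ∈ S) ∧ ∀ t : ℝ, 0 ≤ t → IsCPTP S S (propagator L t)

/-- A Lindblad generator on the full algebra of operators. -/
def IsLindbladGenerator {ι : Type*} [Fintype ι] (L : Module.End ℂ (Matrix ι ι ℂ)) : Prop :=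
  IsLindbladGeneratorOn ⊤ L

/-- The center manifold: the span of the eigenoperators with purely imaginary eigenvalue. -/
def centerManifold {ι : Type*} (L : Module.End ℂ (Matrix ι ι ℂ)) :
    Submodule ℂ (Matrix ι ι ℂ) :=
  Submodule.span ℂ {X | ∃ ω : ℝ, L X = (Complex.I * ω) • X}

/-- `P` is a CPTP `L`-spectral projector onto the center manifold of `L`. -/
structure IsCenterProjector {ι : Type*} [Fintype ι] (L P : Module.End ℂ (Matrix ι ι ℂ)) :
    Prop where
  idem : P ∘ₗ P = P
  range_eq : LinearMap.range P = centerManifold L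
  commute : P ∘ₗ L = L ∘ₗ P
  cptp : IsCPTP ⊤ ⊤ P

/-- The reduced algebra `⊕ₖ B(H_{F,k})`, as the block-diagonal operators on `⊕ₖ H_{F,k}`. -/
def reducedAlgebra {K : Type*} [DecidableEq K] (F : K → Type*) :
    Submodule ℂ (Matrix (Σ k, F k) (Σ k, F k) ℂ) where
  carrier := {X | ∃ Y : ∀ k, Matrix (F k) (F k) ℂ, X = Matrix.blockDiagonal' Y}
  add_mem' := by
    rintro _ _ ⟨Y, rfl⟩ ⟨Z, rfl⟩
    exact ⟨Y + Z, (Matrix.blockDiagonal'_add Y Z).symm⟩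
  zero_mem' := ⟨0, Matrix.blockDiagonal'_zero.symm⟩
  smul_mem' := by
    rintro c _ ⟨Y, rfl⟩
    exact ⟨c • Y, (Matrix.blockDiagonal'_smul c Y).symm⟩

/-- Partial trace over the second tensor factor. -/
def partialTraceRight {m n : Type*} [Fintype n] (X : Matrix (m × n) (m × n) ℂ) :
    Matrix m m ℂ :=
  Matrix.of fun a b => ∑ g, X (a, g) (b, g)

/-- Data of a decomposition `H ≅ ⊕ₖ (H_{F,k} ⊗ H_{G,k}) ⊕ H_R`: the unitary `U` from the right-hand
side onto `H`, and a full-rank density operator `τₖ` on every `H_{G,k}` (full rank expresses that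
`H_R` is exactly the part of `H` that carries no support). -/
structure BlockData (ι : Type*) {K : Type*} (F G : K → Type*) (r : Type*) [Fintype ι]
    [DecidableEq ι] [Fintype K] [DecidableEq K] [∀ k, Fintype (F k)] [∀ k, DecidableEq (F k)]
    [∀ k, Fintype (G k)] [∀ k, DecidableEq (G k)] [Fintype r] [DecidableEq r] where
  U : Matrix ι ((Σ k, F k × G k) ⊕ r) ℂ
  U_conjTranspose_mul : Uᴴ * U = 1
  U_mul_conjTranspose : U * Uᴴ = 1
  τ : ∀ k, Matrix (G k) (G k) ℂ
  τ_posDef : ∀ k, (τ k).PosDef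
  τ_trace : ∀ k, (τ k).trace = 1

namespace BlockData

variable {ι K : Type*} {F G : K → Type*} {r : Type*} [Fintype ι]
    [DecidableEq ι] [Fintype K] [DecidableEq K] [∀ k, Fintype (F k)] [∀ k, DecidableEq (F k)]
    [∀ k, Fintype (G k)] [∀ k, DecidableEq (G k)] [Fintype r] [DecidableEq r]

/-- The operator `Wₖ : H → H_{F,k} ⊗ H_{G,k}`, with `Wₖ Wₖ† = 1`. -/
def W (D : BlockData ι F G r) (k : K) : Matrix (F k × G k) ι ℂ :=
  (D.U.submatrix id fun p : F k × G k => Sum.inl ⟨k, p⟩)ᴴ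

/-- The operator `⊕ₖ (Xₖ ⊗ τₖ) ⊕ 0_R` on `⊕ₖ (H_{F,k} ⊗ H_{G,k}) ⊕ H_R`. -/
def blockState (D : BlockData ι F G r) (X : ∀ k, Matrix (F k) (F k) ℂ) :
    Matrix ((Σ k, F k × G k) ⊕ r) ((Σ k, F k × G k) ⊕ r) ℂ :=
  Matrix.fromBlocks (Matrix.blockDiagonal' fun k => X k ⊗ₖ D.τ k) 0 0 0

/-- The injection super-operator `J(⊕ₖ Xₖ) = U [⊕ₖ (Xₖ ⊗ τₖ) ⊕ 0_R] U†`. Its domain is the reduced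
algebra; on other matrices the formula reads the diagonal blocks only. -/
def injection (D : BlockData ι F G r) :
    Matrix (Σ k, F k) (Σ k, F k) ℂ →ₗ[ℂ] Matrix ι ι ℂ where
  toFun X := D.U * D.blockState (Matrix.blockDiag' X) * D.Uᴴ
  map_add' X Y := by
    have h : D.blockState (Matrix.blockDiag' (X + Y)) =
        D.blockState (Matrix.blockDiag' X) + D.blockState (Matrix.blockDiag' Y) := by
      ext (⟨k, p⟩ | i) (⟨l, q⟩ | j) <;> simp [blockState]
      by_cases hkl : k = l
      · subst hkl
        simp [Matrix.blockDiagonal'_apply, Matrix.blockDiag'_apply, add_mul]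
      · simp [Matrix.blockDiagonal'_apply, hkl]
    rw [h, Matrix.mul_add, Matrix.add_mul]
  map_smul' c X := by
    have h : D.blockState (Matrix.blockDiag' (c • X)) =
        c • D.blockState (Matrix.blockDiag' X) := by
      ext (⟨k, p⟩ | i) (⟨l, q⟩ | j) <;> simp [blockState]
      by_cases hkl : k = l
      · subst hkl
        simp [Matrix.blockDiagonal'_apply, Matrix.blockDiag'_apply, mul_assoc]
      · simp [Matrix.blockDiagonal'_apply, hkl]
    rw [h, Matrix.mul_smul, Matrix.smul_mul, RingHom.id_apply]

/-- The compression `X ↦ ⊕ₖ tr_{G,k}(Wₖ X Wₖ†)`. -/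
def compression (D : BlockData ι F G r) :
    Matrix ι ι ℂ →ₗ[ℂ] Matrix (Σ k, F k) (Σ k, F k) ℂ where
  toFun X := Matrix.blockDiagonal' fun k => partialTraceRight (D.W k * X * (D.W k)ᴴ)
  map_add' X Y := by
    rw [← Matrix.blockDiagonal'_add]
    congr 1
    funext k
    ext a b
    simp [partialTraceRight, Matrix.mul_add, Matrix.add_mul, Finset.sum_add_distrib]
  map_smul' c X := by
    rw [RingHom.id_apply, ← Matrix.blockDiagonal'_smul]
    congr 1
    funext k
    ext a b
    simp [partialTraceRight, Finset.mul_sum]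

/-- The distorted algebra `U [⊕ₖ (B(H_{F,k}) ⊗ τₖ) ⊕ 0_R] U†`. -/
def distortedAlgebra (D : BlockData ι F G r) : Submodule ℂ (Matrix ι ι ℂ) :=
  (reducedAlgebra F).map D.injection

/-- The reduction super-operator `R` of a CPTP projector `P` whose image is the distorted algebra
of `D`: the operator is first brought into that algebra by `P` and then compressed,
`R(X) = ⊕ₖ tr_{G,k}(Wₖ P(X) Wₖ†)`. This is the only map with values in the reduced algebra such
that `J R = P`; the preceding `P` makes it trace preserving on all of `B(H)`, also when `H_R ≠ 0`.
On operators supported on the complement of `H_R` it is the compression itself. -/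
def reduction (D : BlockData ι F G r) (P : Module.End ℂ (Matrix ι ι ℂ)) :
    Matrix ι ι ℂ →ₗ[ℂ] Matrix (Σ k, F k) (Σ k, F k) ℂ :=
  D.compression ∘ₗ P

/-- The reduced generator `R L J`. -/
def reducedGenerator (D : BlockData ι F G r) (P L : Module.End ℂ (Matrix ι ι ℂ)) :
    Module.End ℂ (Matrix (Σ k, F k) (Σ k, F k) ℂ) :=
  D.reduction P ∘ₗ L ∘ₗ D.injection

end BlockData

/-! With `R` the reduction and `J` the injection, `J R = P`, and `R J = 1` on the reduced algebra,
because the compression inverts `J` there and `P` fixes the image of `J`. Both maps are completely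
positive through explicit Kraus operators. The curve `B s = R e^{sL} J` is CPTP on the reduced
algebra, with `B 0 = 1` there and `B' 0 = R L J`, but need not be a semigroup. However, `e^{(t/s)(B
s - 1)}` is a Poisson average of the powers of `B s`, so it is CPTP
(`exp_smul_sub_one_mem_of_convex`). Letting `s → 0` gives `e^{t R L J}`, and CPTP maps form a closed
set. No structure theorem for Lindblad generators is needed. -/

/-! ### Complete positivity: closure properties and Kraus maps. -/

section CompletelyPositive

open Matrix

variable {ι κ μ : Type*}

/-- Positivity of all amplifications of a linear map on matrices with entries in `S`. -/
def IsCompletelyPositiveOn [Fintype ι] [Fintype κ] (S : Submodule ℂ (Matrix ι ι ℂ))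
    (Φ : Matrix ι ι ℂ →ₗ[ℂ] Matrix κ κ ℂ) : Prop :=
  ∀ (m : ℕ) (X : Matrix (Fin m) (Fin m) (Matrix ι ι ℂ)), (∀ i j, X i j ∈ S) →
    (Matrix.comp (Fin m) (Fin m) ι ι ℂ X).PosSemidef →
    (Matrix.comp (Fin m) (Fin m) κ κ ℂ (X.map Φ)).PosSemidef

theorem isClosed_setOf_posSemidef [Fintype ι] : IsClosed {M : Matrix ι ι ℂ | M.PosSemidef} := by
  simp only [Matrix.posSemidef_iff_dotProduct_mulVec, Set.ofPred_and, Set.ofPred_forall]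
  refine IsClosed.inter ?_ (isClosed_iInter fun x => ?_)
  · exact isClosed_eq (by fun_prop) continuous_id
  · exact isClosed_le continuous_const (by fun_prop)

variable [Fintype ι] [Fintype κ] [Fintype μ]

theorem IsCompletelyPositiveOn.congr {S : Submodule ℂ (Matrix ι ι ℂ)}
    {Φ Ψ : Matrix ι ι ℂ →ₗ[ℂ] Matrix κ κ ℂ} (h : IsCompletelyPositiveOn S Φ)
    (hΦ : ∀ X ∈ S, Φ X = Ψ X) : IsCompletelyPositiveOn S Ψ := by
  intro m X hX hpos
  have : X.map Ψ = X.map Φ := by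
    ext i j a b
    simp [hΦ _ (hX i j)]
  rw [this]
  exact h m X hX hpos

theorem IsCompletelyPositiveOn.comp {S : Submodule ℂ (Matrix ι ι ℂ)}
    {T : Submodule ℂ (Matrix κ κ ℂ)} {Φ : Matrix ι ι ℂ →ₗ[ℂ] Matrix κ κ ℂ}
    {Ψ : Matrix κ κ ℂ →ₗ[ℂ] Matrix μ μ ℂ} (hΨ : IsCompletelyPositiveOn T Ψ)
    (hΦ : IsCompletelyPositiveOn S Φ) (h : ∀ X ∈ S, Φ X ∈ T) :
    IsCompletelyPositiveOn S (Ψ ∘ₗ Φ) :=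
  fun m X hX hpos => hΨ m (X.map Φ) (fun i j => h _ (hX i j)) (hΦ m X hX hpos)

theorem IsCompletelyPositiveOn.sum {S : Submodule ℂ (Matrix ι ι ℂ)} {α : Type*} [Fintype α]
    {Φ : α → Matrix ι ι ℂ →ₗ[ℂ] Matrix κ κ ℂ} (h : ∀ a, IsCompletelyPositiveOn S (Φ a)) :
    IsCompletelyPositiveOn S (∑ a, Φ a) := by
  intro m X hX hpos
  have : Matrix.comp (Fin m) (Fin m) κ κ ℂ (X.map ⇑(∑ a, Φ a)) =
      ∑ a, Matrix.comp (Fin m) (Fin m) κ κ ℂ (X.map (Φ a)) := by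
    ext ⟨i, a⟩ ⟨j, b⟩
    simp [Matrix.comp_apply, Matrix.sum_apply]
  rw [this]
  exact Matrix.posSemidef_sum _ fun a _ => h a m X hX hpos

theorem IsCompletelyPositiveOn.smul {S : Submodule ℂ (Matrix ι ι ℂ)}
    {Φ : Matrix ι ι ℂ →ₗ[ℂ] Matrix κ κ ℂ} (h : IsCompletelyPositiveOn S Φ) {c : ℂ} (hc : 0 ≤ c) :
    IsCompletelyPositiveOn S (c • Φ) := by
  intro m X hX hpos
  have : Matrix.comp (Fin m) (Fin m) κ κ ℂ (X.map ⇑(c • Φ)) =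
      c • Matrix.comp (Fin m) (Fin m) κ κ ℂ (X.map Φ) := by
    ext ⟨i, a⟩ ⟨j, b⟩
    simp [Matrix.comp_apply]
  rw [this]
  exact (h m X hX hpos).smul hc

/-- The map `X ↦ A X Aᴴ`. -/
def krausMap (A : Matrix κ ι ℂ) : Matrix ι ι ℂ →ₗ[ℂ] Matrix κ κ ℂ where
  toFun X := A * X * Aᴴ
  map_add' X Y := by rw [Matrix.mul_add, Matrix.add_mul]
  map_smul' c X := by simp

/-- The amplification of `X ↦ A X Aᴴ` is conjugation by `1 ⊗ A`. -/
theorem krausMap_isCompletelyPositiveOn (A : Matrix κ ι ℂ) (S : Submodule ℂ (Matrix ι ι ℂ)) :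
    IsCompletelyPositiveOn S (krausMap A) := by
  intro m X _ hpos
  have : Matrix.comp (Fin m) (Fin m) κ κ ℂ (X.map (krausMap A)) =
      ((1 : Matrix (Fin m) (Fin m) ℂ) ⊗ₖ A) * Matrix.comp (Fin m) (Fin m) ι ι ℂ X *
        ((1 : Matrix (Fin m) (Fin m) ℂ) ⊗ₖ A)ᴴ := by
    ext ⟨i, a⟩ ⟨j, b⟩
    simp [Matrix.comp_apply, krausMap, Matrix.mul_apply, Fintype.sum_prod_type,
      Matrix.one_apply, Finset.sum_mul, Matrix.conjTranspose_apply, apply_ite]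
  rw [this]
  exact hpos.mul_mul_conjTranspose_same _

end CompletelyPositive

/-! ### Kraus forms and traces of the compression and the injection. -/

section BlockMaps

open Matrix

namespace BlockData

variable {ι K : Type*} {F G : K → Type*} {r : Type*} [Fintype ι]
    [DecidableEq ι] [Fintype K] [DecidableEq K] [∀ k, Fintype (F k)] [∀ k, DecidableEq (F k)]
    [∀ k, Fintype (G k)] [∀ k, DecidableEq (G k)] [Fintype r] [DecidableEq r]

/-- The Kraus operators of the compression. -/
def compressionKraus (D : BlockData ι F G r) (p : Σ k, G k) : Matrix (Σ k, F k) ι ℂ :=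
  Matrix.of fun q i => if h : p.1 = q.1 then D.W q.1 (q.2, h ▸ p.2) i else 0

/-- The operator indexed by `(k, g)` is `(1 ⊗ ⟨g|) Wₖ`: summing over `g` takes the partial trace.
Each has its range in a single block, so no off-diagonal block arises. -/
theorem compression_eq_sum (D : BlockData ι F G r) :
    D.compression = ∑ p, krausMap (D.compressionKraus p) := by
  ext1 X
  ext ⟨k, a⟩ ⟨l, b⟩
  simp only [compression, krausMap, LinearMap.sum_apply, Matrix.sum_apply, LinearMap.coe_mk,
    AddHom.coe_mk, blockDiagonal'_apply, Fintype.sum_sigma]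
  rw [Finset.sum_eq_single k]
  · split_ifs with h
    · obtain rfl : k = l := h
      simp [partialTraceRight, compressionKraus, Matrix.mul_apply]
    · have h' : k ≠ l := h
      simp [compressionKraus, Matrix.mul_apply, h']
  · intro j _ hj
    simp [compressionKraus, Matrix.mul_apply, hj]
  · simp

theorem compression_isCompletelyPositiveOn (D : BlockData ι F G r)
    (S : Submodule ℂ (Matrix ι ι ℂ)) : IsCompletelyPositiveOn S D.compression := by
  rw [compression_eq_sum]
  exact .sum fun p => krausMap_isCompletelyPositiveOn _ S

/-- The operators whose Kraus map is `⊕ₖ Xₖ ↦ ⊕ₖ (Xₖ ⊗ Bₖᴴ Bₖ) ⊕ 0`. -/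
def blockStateKraus {r : Type*} (B : ∀ k, Matrix (G k) (G k) ℂ) (p : Σ k, G k) :
    Matrix ((Σ k, F k × G k) ⊕ r) (Σ k, F k) ℂ :=
  Matrix.of fun q s => q.elim (fun q => if h : p.1 = q.1 then
    star (B q.1 (h ▸ p.2) q.2.2) * (if (⟨q.1, q.2.1⟩ : Σ k, F k) = s then 1 else 0) else 0)
    fun _ => 0

/-- Each `τₖ` is the sum of `v vᴴ` over the columns `v` of `Bₖᴴ`, and `Xₖ ⊗ v vᴴ = (1 ⊗ v) Xₖ (1 ⊗
v)ᴴ`. These operators read one block each, so `X` need not be block diagonal. -/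
theorem blockState_eq_sum (D : BlockData ι F G r) (B : ∀ k, Matrix (G k) (G k) ℂ)
    (hB : ∀ k, D.τ k = (B k)ᴴ * B k) (X : Matrix (Σ k, F k) (Σ k, F k) ℂ) :
    D.blockState (blockDiag' X) = ∑ p, krausMap (blockStateKraus B p) X := by
  ext (⟨k, a, g⟩ | i) (⟨l, b, g'⟩ | j)
  · simp only [blockState, krausMap, Matrix.sum_apply, LinearMap.coe_mk,
      AddHom.coe_mk, fromBlocks_apply₁₁, blockDiagonal'_apply, Fintype.sum_sigma]
    rw [Finset.sum_eq_single k]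
    · split_ifs with h
      · obtain rfl : k = l := h
        simp only [dif_pos, hB, blockDiag'_apply, cast_eq, kroneckerMap_apply, Matrix.mul_apply,
          conjTranspose_apply, blockStateKraus, of_apply, Sum.elim_inl, Finset.mul_sum]
        refine Finset.sum_congr rfl fun x _ => ?_
        simp [apply_ite]
        ring
      · have h' : k ≠ l := h
        simp [blockStateKraus, Matrix.mul_apply, h']
    · intro j _ hj
      simp [blockStateKraus, Matrix.mul_apply, hj]
    · simp
  all_goals simp [blockState, krausMap, Matrix.sum_apply, blockStateKraus, Matrix.mul_apply]

open scoped MatrixOrder Matrix.Norms.L2Operator in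
theorem injection_isCompletelyPositiveOn (D : BlockData ι F G r)
    (S : Submodule ℂ (Matrix (Σ k, F k) (Σ k, F k) ℂ)) :
    IsCompletelyPositiveOn S D.injection := by
  -- The scoped L2 operator norm makes matrices a C*-algebra, where nonnegative elements factor as
  -- `star b * b`.
  have hex : ∀ k, ∃ B : Matrix (G k) (G k) ℂ, D.τ k = Bᴴ * B := fun k =>
    CStarAlgebra.nonneg_iff_eq_star_mul_self.mp (D.τ_posDef k).posSemidef.nonneg
  choose B hB using hex
  have : D.injection = krausMap D.U ∘ₗ ∑ p, krausMap (blockStateKraus B p) := by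
    ext1 X
    simp [injection, blockState_eq_sum D B hB, krausMap]
  rw [this]
  exact (krausMap_isCompletelyPositiveOn _ ⊤).comp
    (.sum fun p => krausMap_isCompletelyPositiveOn _ S) fun _ _ => trivial

theorem trace_injection (D : BlockData ι F G r) (X : Matrix (Σ k, F k) (Σ k, F k) ℂ) :
    (D.injection X).trace = X.trace := by
  have h : (D.injection X).trace = (D.blockState (blockDiag' X)).trace := by
    simp only [injection, LinearMap.coe_mk, AddHom.coe_mk]
    rw [Matrix.trace_mul_comm, ← Matrix.mul_assoc, D.U_conjTranspose_mul, Matrix.one_mul]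
  rw [h]
  have ht : ∀ k, ∑ g, D.τ k g g = 1 := D.τ_trace
  simp [Matrix.trace, blockState, Fintype.sum_sigma, Fintype.sum_prod_type, blockDiag'_apply,
    ← Finset.mul_sum, ht]

theorem compression_mem (D : BlockData ι F G r) (X : Matrix ι ι ℂ) :
    D.compression X ∈ reducedAlgebra F :=
  ⟨fun k => partialTraceRight (D.W k * X * (D.W k)ᴴ), rfl⟩

theorem compression_injection (D : BlockData ι F G r) {X : Matrix (Σ k, F k) (Σ k, F k) ℂ}
    (hX : X ∈ reducedAlgebra F) : D.compression (D.injection X) = X := by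
  obtain ⟨Y, rfl⟩ := hX
  simp only [compression, injection, LinearMap.coe_mk, AddHom.coe_mk, blockDiag'_blockDiagonal']
  congr 1
  funext k
  have h : D.W k * (D.U * D.blockState Y * D.Uᴴ) * (D.W k)ᴴ = Y k ⊗ₖ D.τ k := by
    -- `Wₖ` consists of the rows of `Uᴴ` indexed by `e`, so conjugation by it cuts block `k` out of
    -- `Uᴴ (·) U`.
    let e : F k × G k → (Σ k, F k × G k) ⊕ r := fun p => Sum.inl ⟨k, p⟩
    calc _ = (D.Uᴴ * (D.U * D.blockState Y * D.Uᴴ) * D.U).submatrix e e := by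
            rw [W, conjTranspose_conjTranspose, conjTranspose_submatrix]
            rfl
      _ = (D.blockState Y).submatrix e e := by
            rw [Matrix.mul_assoc D.U, ← Matrix.mul_assoc, D.U_conjTranspose_mul, Matrix.one_mul,
              Matrix.mul_assoc, D.U_conjTranspose_mul, Matrix.mul_one]
      _ = _ := by
            ext ⟨a, g⟩ ⟨b, g'⟩
            simp [e, blockState]
  rw [h]
  ext a b
  have ht : ∑ g, D.τ k g g = 1 := D.τ_trace k
  simp [partialTraceRight, ← Finset.mul_sum, ht]

end BlockData

end BlockMaps

/-! ### Semigroups in closed convex monoids. -/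

section ConvexSubmonoid

open Filter Topology NormedSpace

variable {A : Type*} [NormedRing A] [NormedAlgebra ℝ A] [CompleteSpace A]

/-- `e^{l(b-1)} = e^{-l} ∑ lⁿ/n! bⁿ` is the mean of `bⁿ` for a Poisson variable `n` of parameter
`l`. -/
theorem exp_smul_sub_one_mem_of_convex {C : Submonoid A} (hconv : Convex ℝ (C : Set A))
    (hclosed : IsClosed (C : Set A)) {b : A} (hb : b ∈ C) {l : ℝ} (hl : 0 ≤ l) :
    exp (l • (b - 1)) ∈ C := by
  let w : ℕ → ℝ := fun n => (n.factorial : ℝ)⁻¹ * l ^ n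
  have hw : HasSum w (Real.exp l) := by
    rw [Real.exp_eq_exp_ℝ]
    simpa using exp_series_hasSum_exp' (𝕂 := ℝ) l
  have hs : HasSum (fun n => w n • b ^ n) (exp (l • b)) := by
    simpa [w, smul_pow, smul_smul] using exp_series_hasSum_exp' (𝕂 := ℝ) (l • b)
  have hexp : exp (l • (b - 1)) = (Real.exp l)⁻¹ • exp (l • b) := by
    let _ : NormedAlgebra ℚ A := NormedAlgebra.restrictScalars ℚ ℝ A
    have hsplit : l • (b - 1) = algebraMap ℝ A (-l) + l • b := by
      rw [Algebra.algebraMap_eq_smul_one, smul_sub, neg_smul]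
      abel
    rw [hsplit, exp_add_of_commute (Algebra.commute_algebraMap_left _ _), ← algebraMap_exp_comm,
      ← Real.exp_eq_exp_ℝ, ← Algebra.smul_def, Real.exp_neg]
  rw [hexp]
  -- A truncated Poisson sum has total weight different from `e^l` in general; the center of mass
  -- renormalises it to a genuine convex combination.
  have hlim : Tendsto (fun N => (Finset.range N).centerMass w fun n => b ^ n) atTop
      (𝓝 ((Real.exp l)⁻¹ • exp (l • b))) :=
    (hw.tendsto_sum_nat.inv₀ (Real.exp_pos l).ne').smul hs.tendsto_sum_nat
  refine hclosed.mem_of_tendsto hlim ?_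
  filter_upwards [eventually_gt_atTop 0] with N hN
  have hnn : ∀ n, 0 ≤ w n := fun n => by positivity
  refine hconv.centerMass_mem (fun n _ => hnn n) ?_ fun n _ => pow_mem hb n
  -- The weight at `n = 0` is `1`, which keeps the total positive even for `l = 0`.
  exact Finset.sum_pos' (fun n _ => hnn n) ⟨0, Finset.mem_range.mpr hN, by simp [w]⟩

/-- A curve in a closed convex monoid that starts at `1` with velocity `g` generates a semigroup
`e^{t g}` in that monoid. -/
theorem exp_smul_mem_of_hasDerivWithinAt {C : Submonoid A} (hconv : Convex ℝ (C : Set A))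
    (hclosed : IsClosed (C : Set A)) {B : ℝ → A} {g : A}
    (hB : HasDerivWithinAt B g (Set.Ioi 0) 0) (h0 : B 0 = 1) (hmem : ∀ s, 0 < s → B s ∈ C)
    {t : ℝ} (ht : 0 ≤ t) : exp (t • g) ∈ C := by
  let _ : NormedAlgebra ℚ A := NormedAlgebra.restrictScalars ℚ ℝ A
  have hslope := (hasDerivWithinAt_iff_tendsto_slope' (by simp)).mp hB
  have hlim : Tendsto (fun s => exp (t • slope B 0 s)) (𝓝[>] 0) (𝓝 (exp (t • g))) :=
    ((exp_continuous.tendsto _).comp (hslope.const_smul t))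
  refine hclosed.mem_of_tendsto hlim ?_
  filter_upwards [self_mem_nhdsWithin] with s hs
  have hs' : (0 : ℝ) < s := hs
  -- The exponent becomes `(t/s)(B s - 1)`, to which the Poisson mean with `l = t/s` applies.
  rw [slope, h0, vsub_eq_sub, smul_smul]
  exact exp_smul_sub_one_mem_of_convex hconv hclosed (hmem s hs') (by simp; positivity)

end ConvexSubmonoid

/-! ### The semigroup generated by a compressed generator. -/

section Compression

variable {V W : Type*} [NormedAddCommGroup V] [NormedSpace ℂ V] [FiniteDimensional ℂ V]
  [NormedAddCommGroup W] [NormedSpace ℂ W] [FiniteDimensional ℂ W]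

/-- If the maps `1 - R J + R e^{sL} J` lie in a convex monoid that is closed under pointwise
limits, then so does the semigroup generated by `R L J`. -/
theorem endExp_comp_mem {C : Submonoid (Module.End ℂ W)}
    (hconv : Convex ℝ (C : Set (Module.End ℂ W))) {Z : Set (W → W)} (hZ : IsClosed Z)
    (hC : ∀ Φ : Module.End ℂ W, Φ ∈ C ↔ ⇑Φ ∈ Z) {R : V →ₗ[ℂ] W} {J : W →ₗ[ℂ] V}
    {L : Module.End ℂ V} (hmem : ∀ s : ℝ, 0 < s → 1 - R ∘ₗ J + R ∘ₗ endExp L s ∘ₗ J ∈ C)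
    {t : ℝ} (ht : 0 ≤ t) : endExp (R ∘ₗ L ∘ₗ J) t ∈ C := by
  let Rc := LinearMap.toContinuousLinearMap R
  let Jc := LinearMap.toContinuousLinearMap J
  let Lc := LinearMap.toContinuousLinearMap L
  -- The constant `1 - R J` makes `B 0 = 1` on all of `W`, although `R J` may be the identity only
  -- on a subspace; the derivative is unaffected.
  let B : ℝ → W →L[ℂ] W := fun s => 1 - Rc ∘L Jc + Rc ∘L NormedSpace.exp (s • Lc) ∘L Jc
  have : CompleteSpace V := FiniteDimensional.complete ℂ V
  have : CompleteSpace W := FiniteDimensional.complete ℂ W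
  let Cc : Submonoid (W →L[ℂ] W) :=
    { carrier := {Φ | Φ.toLinearMap ∈ C}
      one_mem' := C.one_mem
      mul_mem' := fun h h' => C.mul_mem h h' }
  have hconv' : Convex ℝ (Cc : Set (W →L[ℂ] W)) := fun _ hΦ _ hΨ _ _ ha hb hab =>
    hconv hΦ hΨ ha hb hab
  have hclosed : IsClosed (Cc : Set (W →L[ℂ] W)) := by
    have : (Cc : Set (W →L[ℂ] W)) = (fun Φ : W →L[ℂ] W => (Φ : W → W)) ⁻¹' Z :=
      Set.ext fun Φ => hC Φ.toLinearMap
    rw [this]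
    -- Norm convergence of operators implies pointwise convergence, so pointwise closedness
    -- suffices.
    exact hZ.preimage (continuous_pi fun X => (ContinuousLinearMap.apply ℂ W X).continuous)
  have hexp : HasDerivAt (fun s : ℝ => NormedSpace.exp (s • Lc)) Lc 0 := by
    simpa using hasDerivAt_exp_smul_const (𝕂 := ℝ) Lc (0 : ℝ)
  let conj : (V →L[ℂ] V) →L[ℝ] (W →L[ℂ] W) :=
    (ContinuousLinearMap.compL ℂ W V W Rc ∘L
      (ContinuousLinearMap.compL ℂ W V V).flip Jc).restrictScalars ℝ
  have hB : HasDerivAt B (Rc ∘L Lc ∘L Jc) 0 :=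
    (conj.hasFDerivAt.comp_hasDerivAt (0 : ℝ) hexp).const_add (1 - Rc ∘L Jc)
  have hB0 : B 0 = 1 := by
    ext X
    simp [B]
  exact exp_smul_mem_of_hasDerivWithinAt hconv' hclosed hB.hasDerivWithinAt hB0 hmem ht

end Compression

/-! ### The monoid of CPTP maps and reduction of Lindblad generators. -/

section Reduction

variable {ι κ μ : Type*} [Fintype ι] [Fintype κ] [Fintype μ]

theorem isCPTP_iff {S : Submodule ℂ (Matrix ι ι ℂ)} {T : Submodule ℂ (Matrix κ κ ℂ)}
    {Φ : Matrix ι ι ℂ →ₗ[ℂ] Matrix κ κ ℂ} :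
    IsCPTP S T Φ ↔ (∀ X ∈ S, Φ X ∈ T) ∧ IsCompletelyPositiveOn S Φ ∧
      ∀ X ∈ S, (Φ X).trace = X.trace := Iff.rfl

theorem IsCPTP.congr {S : Submodule ℂ (Matrix ι ι ℂ)} {T : Submodule ℂ (Matrix κ κ ℂ)}
    {Φ Ψ : Matrix ι ι ℂ →ₗ[ℂ] Matrix κ κ ℂ} (h : IsCPTP S T Φ) (hΦ : ∀ X ∈ S, Φ X = Ψ X) :
    IsCPTP S T Ψ :=
  ⟨fun X hX => hΦ X hX ▸ h.1 X hX, IsCompletelyPositiveOn.congr h.2.1 hΦ,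
    fun X hX => hΦ X hX ▸ h.2.2 X hX⟩

theorem IsCPTP.comp {S : Submodule ℂ (Matrix ι ι ℂ)} {T : Submodule ℂ (Matrix κ κ ℂ)}
    {R : Submodule ℂ (Matrix μ μ ℂ)} {Φ : Matrix ι ι ℂ →ₗ[ℂ] Matrix κ κ ℂ}
    {Ψ : Matrix κ κ ℂ →ₗ[ℂ] Matrix μ μ ℂ} (hΨ : IsCPTP T R Ψ) (hΦ : IsCPTP S T Φ) :
    IsCPTP S R (Ψ ∘ₗ Φ) :=
  ⟨fun X hX => hΨ.1 _ (hΦ.1 X hX), IsCompletelyPositiveOn.comp hΨ.2.1 hΦ.2.1 hΦ.1,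
    fun X hX => (hΨ.2.2 _ (hΦ.1 X hX)).trans (hΦ.2.2 X hX)⟩

theorem IsCPTP.id (S : Submodule ℂ (Matrix ι ι ℂ)) : IsCPTP S S LinearMap.id :=
  ⟨fun _ hX => hX, fun _ _ _ hpos => hpos, fun _ _ => rfl⟩

/-- The monoid of maps whose restriction to `S` is completely positive and trace preserving. -/
def cptpSubmonoid (S : Submodule ℂ (Matrix ι ι ℂ)) : Submonoid (Module.End ℂ (Matrix ι ι ℂ)) where
  carrier := {Φ | IsCPTP S S Φ}
  one_mem' := IsCPTP.id S
  mul_mem' hΦ hΨ := hΦ.comp hΨ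

theorem convex_cptpSubmonoid (S : Submodule ℂ (Matrix ι ι ℂ)) :
    Convex ℝ (cptpSubmonoid S : Set (Module.End ℂ (Matrix ι ι ℂ))) := by
  rintro Φ hΦ Ψ hΨ a b ha hb hab
  have hab' : (a : ℂ) + b = 1 := by exact_mod_cast hab
  change IsCPTP S S ((a : ℂ) • Φ + (b : ℂ) • Ψ)
  refine isCPTP_iff.mpr ⟨fun X hX => ?_, ?_, fun X hX => ?_⟩
  · exact S.add_mem (S.smul_mem _ (hΦ.1 X hX)) (S.smul_mem _ (hΨ.1 X hX))
  · have := IsCompletelyPositiveOn.sum (S := S) (Φ := ![(a : ℂ) • Φ, (b : ℂ) • Ψ]) (by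
        intro i
        fin_cases i
        · exact IsCompletelyPositiveOn.smul hΦ.2.1 (by simpa using ha)
        · exact IsCompletelyPositiveOn.smul hΨ.2.1 (by simpa using hb))
    simpa [Fin.sum_univ_two] using this
  · simp [hΦ.2.2 X hX, hΨ.2.2 X hX, ← add_mul, hab']

/-- Being CPTP on `S` is a pointwise closed condition. -/
theorem isClosed_cptp (S : Submodule ℂ (Matrix ι ι ℂ)) :
    IsClosed {f : Matrix ι ι ℂ → Matrix ι ι ℂ | (∀ X ∈ S, f X ∈ S) ∧
      (∀ (m : ℕ) (X : Matrix (Fin m) (Fin m) (Matrix ι ι ℂ)), (∀ i j, X i j ∈ S) →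
        (Matrix.comp (Fin m) (Fin m) ι ι ℂ X).PosSemidef →
        (Matrix.comp (Fin m) (Fin m) ι ι ℂ (X.map f)).PosSemidef) ∧
      ∀ X ∈ S, (f X).trace = X.trace} := by
  simp only [Set.ofPred_and, Set.ofPred_forall]
  refine IsClosed.inter ?_ (IsClosed.inter ?_ ?_)
  · exact isClosed_biInter fun X _ =>
      S.closed_of_finiteDimensional.preimage (continuous_apply X)
  · refine isClosed_iInter fun m => isClosed_iInter fun X => isClosed_iInter fun _ =>
      isClosed_iInter fun _ => isClosed_setOf_posSemidef.preimage ?_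
    refine continuous_pi fun p => continuous_pi fun q => ?_
    exact (continuous_apply_apply p.2 q.2).comp (continuous_apply (X p.1 q.1))
  · exact isClosed_biInter fun X _ =>
      isClosed_eq ((continuous_apply X).matrix_trace) continuous_const

attribute [local instance] Matrix.normedAddCommGroup Matrix.normedSpace

/-- Compressing a Lindblad generator on `S` by CPTP maps `R`, `J` with `R J = 1` on `T` gives a
Lindblad generator on `T`. -/
theorem IsLindbladGeneratorOn.reduce {S : Submodule ℂ (Matrix ι ι ℂ)}
    {T : Submodule ℂ (Matrix κ κ ℂ)} {R : Matrix ι ι ℂ →ₗ[ℂ] Matrix κ κ ℂ}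
    {J : Matrix κ κ ℂ →ₗ[ℂ] Matrix ι ι ℂ} {L : Module.End ℂ (Matrix ι ι ℂ)}
    (hL : IsLindbladGeneratorOn S L) (hR : IsCPTP S T R) (hJ : IsCPTP T S J)
    (hRJ : ∀ X ∈ T, R (J X) = X) : IsLindbladGeneratorOn T (R ∘ₗ L ∘ₗ J) := by
  refine ⟨fun X hX => hR.1 _ (hL.1 _ (hJ.1 X hX)), fun t ht => ?_⟩
  refine endExp_comp_mem (C := cptpSubmonoid T) (convex_cptpSubmonoid T) (isClosed_cptp T)
    (fun Φ => Iff.rfl) (fun s hs => ?_) ht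
  -- On `T` the correction `1 - R J` vanishes, and being CPTP on `T` depends only on the values
  -- there.
  refine IsCPTP.congr (hR.comp ((hL.2 s hs.le).comp hJ)) fun X hX => ?_
  simp [hRJ X hX, propagator]

end Reduction

/-! ### Assembly for the center manifold. -/

theorem corollary4p1
    {ι K : Type*} {F G : K → Type*} {r : Type*} [Fintype ι] [DecidableEq ι]
    [Fintype K] [DecidableEq K] [∀ k, Fintype (F k)] [∀ k, DecidableEq (F k)]
    [∀ k, Fintype (G k)] [∀ k, DecidableEq (G k)] [Fintype r] [DecidableEq r]
    (L : ℝ → Module.End ℂ (Matrix ι ι ℂ)) (hL : ∀ ε, IsLindbladGenerator (L ε))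
    (P : Module.End ℂ (Matrix ι ι ℂ)) (hP : IsCenterProjector (L 0) P)
    (D : BlockData ι F G r) (hD : D.distortedAlgebra = centerManifold (L 0)) :
    -- `R` and `J` are CPTP factors of the projector
    (IsCPTP ⊤ (reducedAlgebra F) (D.reduction P) ∧
      IsCPTP (reducedAlgebra F) ⊤ D.injection ∧
      D.injection ∘ₗ D.reduction P = P ∧
      ∀ X ∈ reducedAlgebra F, D.reduction P (D.injection X) = X) ∧
    ∀ ε : ℝ,
      -- the reduced generator is Lindblad on the reduced center algebra
      IsLindbladGeneratorOn (reducedAlgebra F) (D.reducedGenerator P (L ε)) ∧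
      -- and leaves it invariant
      (∀ X ∈ reducedAlgebra F, D.reducedGenerator P (L ε) X ∈ reducedAlgebra F) ∧
      -- wherever the generator is the sum of a power series, so is the reduced generator
      (∀ Lk : ℕ → Module.End ℂ (Matrix ι ι ℂ),
        (∀ X, HasSum (fun k : ℕ => ((ε : ℂ) ^ k) • Lk k X) (L ε X)) →
        ∀ X ∈ reducedAlgebra F,
          HasSum (fun k : ℕ => ((ε : ℂ) ^ k) • D.reducedGenerator P (Lk k) X)
            (D.reducedGenerator P (L ε) X)) := by
  have hrange : ∀ X, ∃ Y ∈ reducedAlgebra F, D.injection Y = P X := fun X => by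
    have h : P X ∈ D.distortedAlgebra := by
      rw [hD, ← hP.range_eq]
      exact LinearMap.mem_range_self P X
    exact Submodule.mem_map.mp h
  have hfix : ∀ Y ∈ reducedAlgebra F, P (D.injection Y) = D.injection Y := fun Y hY => by
    have h : D.injection Y ∈ LinearMap.range P := by
      rw [hP.range_eq, ← hD]
      exact Submodule.mem_map_of_mem hY
    obtain ⟨Z, hZ⟩ := h
    rw [← hZ]
    exact LinearMap.congr_fun hP.idem Z
  have hRJ : ∀ X ∈ reducedAlgebra F, D.reduction P (D.injection X) = X := fun X hX => by
    rw [BlockData.reduction, LinearMap.comp_apply, hfix X hX, D.compression_injection hX]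
  have hJR : D.injection ∘ₗ D.reduction P = P := by
    refine LinearMap.ext fun X => ?_
    obtain ⟨Y, hY, hYX⟩ := hrange X
    rw [LinearMap.comp_apply, BlockData.reduction, LinearMap.comp_apply, ← hYX,
      D.compression_injection hY]
  have hJ : IsCPTP (reducedAlgebra F) ⊤ D.injection :=
    ⟨fun _ _ => trivial, D.injection_isCompletelyPositiveOn _, fun X _ => D.trace_injection X⟩
  have hR : IsCPTP ⊤ (reducedAlgebra F) (D.reduction P) := by
    refine ⟨fun X _ => D.compression_mem _, ?_, fun X hX => ?_⟩
    · exact IsCompletelyPositiveOn.comp (D.compression_isCompletelyPositiveOn ⊤) hP.cptp.2.1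
        fun _ _ => trivial
    -- The compression alone loses the trace carried by `H_R`; here `tr R X = tr J R X = tr P X = tr
    -- X`.
    · rw [← D.trace_injection, ← LinearMap.comp_apply, hJR]
      exact hP.cptp.2.2 X hX
  refine ⟨⟨hR, hJ, hJR, hRJ⟩, fun ε => ?_⟩
  have hgen : IsLindbladGeneratorOn (reducedAlgebra F) (D.reducedGenerator P (L ε)) :=
    IsLindbladGeneratorOn.reduce (hL ε) hR hJ hRJ
  refine ⟨hgen, hgen.1, fun Lk hLk X _ => ?_⟩
  have hsum := (hLk (D.injection X)).map (D.reduction P)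
    (LinearMap.continuous_of_finiteDimensional _)
  simpa [Function.comp_def, BlockData.reducedGenerator] using hsum
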